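/- Let $\mathcal U$ be a universe, and consider turnstile streams $x$ of length $T$: each entry is an insertion $+u$, a deletion $-u$ ($u\in\mathcal U$), or a no-op $\perp$. The existence vector of $u$ in $x$ equals $1$ at time $t$ if the first $t$ entries of $x$ contain strictly more insertions than deletions of $u$, and $0$ otherwise. $\mathsf{CountDistinct}(x)[t]$ is the sum over $u\in\mathcal U$ of these indicators at time $t$. The flippancy of $u$ in $x$ is the number of pairs of adjacent entries of its existence vector with different values, and the maximum flippancy of $x$ is the maximum of this over $u$. Two streams are item-neighbors if one is obtained from the other by replacing with $\perp$ a subset of the entries pertaining to a single element $u$. A mechanism (in the continual release model) outputs online a random vector of answers in $\mathbb R^T$, the first $t$ answers depending only on the first $t$ entries and on its randomness. It is $(\varepsilon,\delta)$-item-level-DP if for all item-neighbors $x,x'\in\mathcal U_\pm^T$ and all events $S$, $\Pr[\mathcal M(x)\in S]\le e^{\varepsilon}\Pr[\mathcal M(x')\in S]+\delta$. It is $\alpha$-accurate for $\mathsf{CountDistinct}$ on streams with maximum flippancy at most $w$ if on each such stream $x$, with probability at least $0.99$, its answer vector $a$ satisfies $\|\mathsf{CountDistinct}(x)-a\|_\infty\le\alpha$.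 **Theorem (item-level lower bound).** 1. There are absolute constants $\eta,c>0$ and $k,N\in\mathbb N$ such that for all $w,T\in\mathbb N$ with $N\le w\le T$, all $\varepsilon\in(0,1]$, all $0\le\delta\le\eta\,\varepsilon/T$, and every universe $\mathcal U$ with at least $T$ elements: every $(\varepsilon,\delta)$-item-level-DP mechanism that is $\alpha$-accurate for $\mathsf{CountDistinct}$ on turnstile streams of length $T$ with maximum flippancy at most $w$ satisfies $$\alpha\ \ge\ c\,\frac{f}{\log^k f},\qquad f=\min\Big(\frac{\sqrt w}{\varepsilon},\ \frac{T^{1/3}}{\varepsilon^{2/3}},\ T\Big).$$ In particular, if $\delta=o(\varepsilon/T)$, then $\alpha=\tilde\Omega\big(\min(\sqrt w/\varepsilon,\ T^{1/3}/\varepsilon^{2/3},\ T)\big)$. 2. There are absolute constants $c>0$ and $N\in\mathbb N$ such that for all $w,T\in\mathbb N$ with $N\le w\le T$, all $\varepsilon\in(0,1]$, and every universe $\mathcal U$ with at least $T$ elements: every $(\varepsilon,0)$-item-level-DP mechanism that is $\alpha$-accurate for $\mathsf{CountDistinct}$ on turnstile streams of length $T$ with maximum flippancy at most $w$ satisfies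 $$\alpha\ \ge\ c\,\min\Big(\frac{w}{\varepsilon},\ \sqrt{\frac T\varepsilon},\ T\Big).$$ -/

import Mathlib

open MeasureTheory

universe u

namespace TurnstileDP

/-- An entry of a turnstile stream over the universe `U`: an insertion `+u`, a deletion `-u`,
or the no-op `⊥`. -/
inductive Entry (U : Type u) : Type u
  | ins (a : U) : Entry U
  | del (a : U) : Entry U
  | noop : Entry U

/-- Turnstile streams of length `T`; the time steps `1, …, T` are indexed by `Fin T`. -/
abbrev Stream (U : Type u) (T : ℕ) : Type u := Fin T → Entry U

section
variable {U : Type u} {T : ℕ}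

/-- The number of insertions of `a` in the prefix of `x` ending at time `t` (inclusive). -/
noncomputable def insCount (x : Stream U T) (a : U) (t : Fin T) : ℕ :=
  {s : Fin T | s ≤ t ∧ x s = Entry.ins a}.ncard

/-- The number of deletions of `a` in the prefix of `x` ending at time `t` (inclusive). -/
noncomputable def delCount (x : Stream U T) (a : U) (t : Fin T) : ℕ :=
  {s : Fin T | s ≤ t ∧ x s = Entry.del a}.ncard

open Classical in
/-- The existence vector of `a` in `x`: it is `1` at time `t` iff the prefix of `x` up to `t` has
strictly more insertions than deletions of `a`. -/
noncomputable def existence (x : Stream U T) (a : U) (t : Fin T) : ℕ :=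
  if delCount x a t < insCount x a t then 1 else 0

/-- Only elements that are inserted at some time contribute, so the sum over the universe in
`countDistinct` is a finite one even if the universe is infinite. -/
theorem existence_support_finite (x : Stream U T) (t : Fin T) :
    (Function.support fun a => existence x a t).Finite := by
  classical
  have hfin : (⋃ s : Fin T, {a : U | x s = Entry.ins a}).Finite := by
    refine Set.finite_iUnion fun s => Set.Subsingleton.finite ?_
    intro a ha b hb
    have h : Entry.ins a = Entry.ins b := (show x s = Entry.ins a from ha).symm.trans hb
    exact Entry.ins.inj h
  refine hfin.subset fun a ha => ?_
  have hpos : delCount x a t < insCount x a t := by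
    by_contra hcon
    exact ha (by simp [existence, hcon])
  have hne : {s : Fin T | s ≤ t ∧ x s = Entry.ins a}.Nonempty :=
    Set.nonempty_of_ncard_ne_zero (by unfold insCount at hpos; omega)
  obtain ⟨s, -, hs⟩ := hne
  exact Set.mem_iUnion.2 ⟨s, hs⟩

/-- The number of distinct elements present at time `t`: the sum over all elements of the universe
of the entries at `t` of their existence vectors. -/
noncomputable def countDistinct (x : Stream U T) (t : Fin T) : ℕ :=
  ∑ᶠ a : U, existence x a t

/-- The flippancy of `a` in `x`: the number of adjacent pairs of entries of the existence vector
with different values. -/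
noncomputable def flip (a : U) (x : Stream U T) : ℕ :=
  {j : Fin T | ∃ h : j.1 + 1 < T, existence x a j ≠ existence x a ⟨j.1 + 1, h⟩}.ncard

/-- The flippancies of the elements in a stream of length `T` are at most `T`, so the supremum in
`maxFlippancy` is a maximum (over a nonempty universe). -/
theorem flip_bddAbove (x : Stream U T) : BddAbove (Set.range fun a : U => flip a x) := by
  refine ⟨T, ?_⟩
  rintro _ ⟨a, rfl⟩
  have h := Set.ncard_le_card
    {j : Fin T | ∃ h : j.1 + 1 < T, existence x a j ≠ existence x a ⟨j.1 + 1, h⟩}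
  simpa [flip] using h

/-- The maximum flippancy of `x` over all elements of the universe. -/
noncomputable def maxFlippancy (x : Stream U T) : ℕ := ⨆ a : U, flip a x

/-- `y` is obtained from `x` by replacing with `⊥` a subset of the entries of `x` that pertain
to `a`. -/
def ErasesItem (a : U) (x y : Stream U T) : Prop :=
  ∀ t, y t = x t ∨ (y t = Entry.noop ∧ (x t = Entry.ins a ∨ x t = Entry.del a))

/-- Item-neighboring streams. -/
def ItemNeighbors (x y : Stream U T) : Prop :=
  ∃ a : U, ErasesItem a x y ∨ ErasesItem a y x

/-- The error `‖CountDistinct(x) - r‖_∞` of an answer vector `r`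
(`Fin T → ℝ` carries the sup norm). -/
noncomputable def answerError (x : Stream U T) (r : Fin T → ℝ) : ℝ :=
  ‖(fun t => (countDistinct x t : ℝ)) - r‖

end

/-- A randomized mechanism in the continual release model for streams of length `T`: each input
stream is assigned the law of the vector of answers. Answers are released online: the joint law of
the answers up to time `t` depends only on the stream entries up to time `t`. -/
structure Mechanism (U : Type u) (T : ℕ) where
  /-- The law of the vector of answers on a given input stream. -/
  law : Stream U T → Measure (Fin T → ℝ)
  isProb : ∀ x, IsProbabilityMeasure (law x)
  causal : ∀ (x y : Stream U T) (t : Fin T), (∀ s, s ≤ t → x s = y s) →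
    (law x).map (fun r (s : {s : Fin T // s ≤ t}) => r s.1) =
      (law y).map (fun r (s : {s : Fin T // s ≤ t}) => r s.1)

section
variable {U : Type u} {T : ℕ}

/-- `(ε, δ)`-item-level differential privacy. -/
def Mechanism.ItemLevelDP (M : Mechanism U T) (ε δ : ℝ) : Prop :=
  ∀ x y : Stream U T, ItemNeighbors x y → ∀ S : Set (Fin T → ℝ), MeasurableSet S →
    M.law x S ≤ ENNReal.ofReal (Real.exp ε) * M.law y S + ENNReal.ofReal δ

/-- `M` is `α`-accurate for `CountDistinct` on the streams with maximum flippancy at most `w`: on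
each such stream the error is at most `α` with probability at least `0.99`. -/
def Mechanism.AccurateUpTo (M : Mechanism U T) (w : ℕ) (α : ℝ) : Prop :=
  ∀ x : Stream U T, maxFlippancy x ≤ w →
    ENNReal.ofReal 0.99 ≤ M.law x {r | answerError x r ≤ α}

end

/-- `min (√w / ε, T^(1/3) / ε^(2/3), T)`. -/
noncomputable def approxDPBound (w T : ℕ) (ε : ℝ) : ℝ :=
  min (min (Real.sqrt w / ε) ((T : ℝ) ^ (1 / 3 : ℝ) / ε ^ (2 / 3 : ℝ))) T

/-- `min (w / ε, √(T / ε), T)`. -/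
noncomputable def pureDPBound (w T : ℕ) (ε : ℝ) : ℝ :=
  min (min ((w : ℝ) / ε) (Real.sqrt (T / ε))) T

end TurnstileDP

/-! A binary matrix with `n` rows and `d` columns is written as a stream of `d` blocks of length `2
* n`: each block inserts the elements of one column and then deletes them. Midway through a block
the distinct count is the size of the column, so an accurate mechanism answers all one-way
marginals. The flippancy is at most `2 * d`, and zeroing a row is an item-neighbor step
(`erasesItem_encode`, `maxFlippancy_encode`, `countDistinct_encode`). It remains to bound the error
of private marginals from below.

For approximate privacy this is a fingerprinting argument. Each column consists of trials with a
common uniform bias, and the answers are correlated with the centred entries of each row. If the row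
is erased before answering, the answers are independent of it given the rest; the correlation then
has mean zero and mean absolute value at most `√d`. Privacy therefore caps the mean correlation with
a row at `2ε√d + 2δd` (`sum_integral_correlation_le`). Accurate answers force the sum over rows to
be of order `d` (`le_integral_sum_correlation`). Hence the error is of order `n` once `nε ≲ √d` and
`nδ ≲ 1` (`marginals_lower_bound`).

For pure privacy a packing suffices: the `2 ^ d` matrices with full or empty columns have disjoint
sets of accurate answers when `α < n / 2`, and each such set has mass at least `0.99 e^(-nε)` under
the empty matrix (`marginals_packing_bound`).

Finally `n` is a constant fraction of the claimed bound, and `d` is the least number of columns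
allowed by `ε`; the conditions `2d ≤ w` and `2nd ≤ T` are what the minimum encodes. -/

namespace TurnstileDP

/-! ### Expectations under indistinguishable laws -/

section Indistinguishability
variable {Ω : Type*} [MeasurableSpace Ω]

/-- Layer cake: the inequality for the events `{t ≤ Z}` is integrated over `t` in `(0, B]`. -/
theorem integral_le_of_measure_le {P Q : Measure Ω} [IsProbabilityMeasure P]
    [IsProbabilityMeasure Q] {K δ B : ℝ} (hK : 0 ≤ K) (hδ : 0 ≤ δ)
    (h : ∀ S, MeasurableSet S → P S ≤ ENNReal.ofReal K * Q S + ENNReal.ofReal δ)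
    {Z : Ω → ℝ} (hZ : Measurable Z) (h0 : ∀ r, 0 ≤ Z r) (hB : ∀ r, Z r ≤ B) (hB0 : 0 ≤ B) :
    ∫ r, Z r ∂P ≤ K * ∫ r, Z r ∂Q + δ * B := by
  have hint : ∀ μ : Measure Ω, IsProbabilityMeasure μ → Integrable Z μ := fun μ _ =>
    Integrable.of_bound hZ.aestronglyMeasurable B
      (ae_of_all _ fun r => by rw [Real.norm_eq_abs, abs_of_nonneg (h0 r)]; exact hB r)
  have hreal : ∀ S, MeasurableSet S → P.real S ≤ K * Q.real S + δ := by
    intro S hS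
    have := ENNReal.toReal_mono (by finiteness) (h S hS)
    rwa [ENNReal.toReal_add (by finiteness) (by finiteness), ENNReal.toReal_mul,
      ENNReal.toReal_ofReal hK, ENNReal.toReal_ofReal hδ] at this
  have htail : ∀ μ : Measure Ω, IsProbabilityMeasure μ →
      IntegrableOn (fun t => μ.real {r | t ≤ Z r}) (Set.Ioc 0 B) := by
    intro μ _
    have hanti : Antitone fun t : ℝ => μ.real {r | t ≤ Z r} := fun s t hst =>
      measureReal_mono fun r hr => le_trans hst hr
    exact ((hanti.antitoneOn _).integrableOn_isCompact isCompact_Icc).mono_set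
      Set.Ioc_subset_Icc_self
  rw [(hint P ‹_›).integral_eq_integral_Ioc_meas_le (ae_of_all _ h0) (ae_of_all _ hB),
    (hint Q ‹_›).integral_eq_integral_Ioc_meas_le (ae_of_all _ h0) (ae_of_all _ hB)]
  have hc : IntegrableOn (fun _ : ℝ => δ) (Set.Ioc 0 B) := integrableOn_const (by simp)
  calc ∫ t in Set.Ioc 0 B, P.real {r | t ≤ Z r}
      ≤ ∫ t in Set.Ioc 0 B, (K * Q.real {r | t ≤ Z r} + δ) :=
        integral_mono (htail P ‹_›) (((htail Q ‹_›).const_mul K).add hc)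
          fun t => hreal _ (measurableSet_le measurable_const hZ)
    _ = K * (∫ t in Set.Ioc 0 B, Q.real {r | t ≤ Z r}) + δ * B := by
        rw [integral_add ((htail Q ‹_›).const_mul K) hc, integral_const_mul]
        simp [hB0, mul_comm]

/-- The positive part of `Z` is compared in one direction and the negative part in the other. The
multiplicative loss is thus charged to `|Z|` under `Q` alone, where `Q` will be the law with a row
erased. -/
theorem integral_le_integral_add {P Q : Measure Ω} [IsProbabilityMeasure P]
    [IsProbabilityMeasure Q] {ε δ B : ℝ} (hε : 0 ≤ ε) (hε1 : ε ≤ 1) (hδ : 0 ≤ δ)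
    (hPQ : ∀ S, MeasurableSet S →
      P S ≤ ENNReal.ofReal (Real.exp ε) * Q S + ENNReal.ofReal δ)
    (hQP : ∀ S, MeasurableSet S →
      Q S ≤ ENNReal.ofReal (Real.exp ε) * P S + ENNReal.ofReal δ)
    {Z : Ω → ℝ} (hZ : Measurable Z) (hB : ∀ r, |Z r| ≤ B) (hB0 : 0 ≤ B) :
    ∫ r, Z r ∂P ≤ ∫ r, Z r ∂Q + 2 * ε * ∫ r, |Z r| ∂Q + 2 * δ * B := by
  have hp : Measurable fun r => max (Z r) 0 := hZ.max measurable_const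
  have hm : Measurable fun r => max (-Z r) 0 := hZ.neg.max measurable_const
  have hpB : ∀ r, max (Z r) 0 ≤ B := fun r => max_le ((le_abs_self _).trans (hB r)) hB0
  have hmB : ∀ r, max (-Z r) 0 ≤ B := fun r => max_le ((neg_le_abs _).trans (hB r)) hB0
  have hip : ∀ μ : Measure Ω, IsProbabilityMeasure μ → Integrable (fun r => max (Z r) 0) μ :=
    fun μ _ => Integrable.of_bound hp.aestronglyMeasurable B
      (ae_of_all _ fun r => by
        rw [Real.norm_eq_abs, abs_of_nonneg (le_max_right _ _)]; exact hpB r)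
  have him : ∀ μ : Measure Ω, IsProbabilityMeasure μ → Integrable (fun r => max (-Z r) 0) μ :=
    fun μ _ => Integrable.of_bound hm.aestronglyMeasurable B
      (ae_of_all _ fun r => by
        rw [Real.norm_eq_abs, abs_of_nonneg (le_max_right _ _)]; exact hmB r)
  have hsub : ∀ μ : Measure Ω, IsProbabilityMeasure μ →
      ∫ r, Z r ∂μ = ∫ r, max (Z r) 0 ∂μ - ∫ r, max (-Z r) 0 ∂μ := by
    intro μ _
    rw [← integral_sub (hip μ ‹_›) (him μ ‹_›)]
    refine integral_congr_ae (ae_of_all _ fun r => ?_)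
    rcases le_total 0 (Z r) with h | h <;> simp [h]
  have habs : ∫ r, |Z r| ∂Q = ∫ r, max (Z r) 0 ∂Q + ∫ r, max (-Z r) 0 ∂Q := by
    rw [← integral_add (hip Q ‹_›) (him Q ‹_›)]
    refine integral_congr_ae (ae_of_all _ fun r => ?_)
    rcases le_total 0 (Z r) with h | h <;> simp [h, abs_of_nonneg, abs_of_nonpos]
  have h1 := integral_le_of_measure_le (Real.exp_nonneg ε) hδ hPQ hp
    (fun r => le_max_right _ _) hpB hB0
  have h2 := integral_le_of_measure_le (Real.exp_nonneg ε) hδ hQP hm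
    (fun r => le_max_right _ _) hmB hB0
  rw [hsub P ‹_›, hsub Q ‹_›, habs]
  have hp0 : 0 ≤ ∫ r, max (Z r) 0 ∂Q := integral_nonneg fun r => le_max_right _ _
  have hm0 : 0 ≤ ∫ r, max (-Z r) 0 ∂Q := integral_nonneg fun r => le_max_right _ _
  have hm0' : 0 ≤ ∫ r, max (-Z r) 0 ∂P := integral_nonneg fun r => le_max_right _ _
  have hK1 : 1 ≤ Real.exp ε := Real.one_le_exp hε
  have hK : Real.exp ε ≤ 1 + 2 * ε := by
    have := Real.abs_exp_sub_one_le (x := ε) (by rwa [abs_of_nonneg hε])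
    rw [abs_of_nonneg hε] at this
    linarith [le_abs_self (Real.exp ε - 1)]
  have hδB : 0 ≤ δ * B := mul_nonneg hδ hB0
  generalize Real.exp ε = K at *
  generalize (∫ r, max (-Z r) 0 ∂Q) = y at *
  generalize (∫ r, max (-Z r) 0 ∂P) = x at *
  generalize (∫ r, max (Z r) 0 ∂Q) = z at *
  -- This solves `y ≤ K x + δ B` for `x`, using `1 / K ≥ 2 - K`; if `y ≤ δ B` the left side is
  -- nonpositive.
  have h3 : y - (K - 1) * y - δ * B ≤ x := by
    rcases le_total y (δ * B) with hy | hy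
    · nlinarith [mul_nonneg (sub_nonneg.2 hK1) hm0]
    · have h4 : y - δ * B ≤ K * x := by linarith
      by_contra! hx
      nlinarith [mul_nonneg (sub_nonneg.2 hK1) hδB,
        mul_pos (lt_of_lt_of_le one_pos hK1) (sub_pos.2 hx),
        mul_nonneg (sub_nonneg.2 hK1) (mul_nonneg (sub_nonneg.2 hK1) (sub_nonneg.2 hy)),
        mul_nonneg (sub_nonneg.2 hK1) (mul_nonneg (sub_nonneg.2 hK1) hδB)]
  nlinarith [mul_nonneg (sub_nonneg.2 hK) hm0, mul_nonneg (sub_nonneg.2 hK) hp0]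

end Indistinguishability

/-! ### The random matrix and its scores -/

section Prior
variable {n d : ℕ}

/-- The law of a set of successes after `n` exchangeable trials with uniform bias. -/
noncomputable def priorWeight (S : Finset (Fin n)) : ℝ :=
  (((n : ℝ) + 1) * (n.choose S.card : ℝ))⁻¹

/-- The indicator of `i ∈ S` minus its conditional mean given `S \ {i}` under `priorWeight`. -/
noncomputable def score (i : Fin n) (S : Finset (Fin n)) : ℝ :=
  (if i ∈ S then 1 else 0) - (((S.erase i).card : ℝ) + 1) / (n + 1)

theorem card_le_n (S : Finset (Fin n)) : S.card ≤ n := by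
  simpa using Finset.card_le_univ S

theorem priorWeight_nonneg (S : Finset (Fin n)) : 0 ≤ priorWeight S := by
  unfold priorWeight; positivity

/-- Under a uniform bias the number of successes is uniform on `0, …, n`. -/
theorem sum_priorWeight_mul (F : ℕ → ℝ) :
    ∑ S : Finset (Fin n), priorWeight S * F S.card =
      (∑ k ∈ Finset.range (n + 1), F k) / (n + 1) := by
  have h := Finset.sum_powerset_apply_card (x := (Finset.univ : Finset (Fin n)))
    fun k => (((n : ℝ) + 1) * (n.choose k : ℝ))⁻¹ * F k
  rw [Finset.powerset_univ] at h
  simp only [Finset.card_univ, Fintype.card_fin, nsmul_eq_mul] at h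
  unfold priorWeight
  rw [h, Finset.sum_div]
  refine Finset.sum_congr rfl fun k hk => ?_
  have hc : (n.choose k : ℝ) ≠ 0 := by
    have := Nat.choose_pos (Nat.lt_succ_iff.1 (Finset.mem_range.1 hk))
    positivity
  field_simp

theorem sum_priorWeight : ∑ S : Finset (Fin n), priorWeight S = 1 := by
  have h := sum_priorWeight_mul (n := n) fun _ => 1
  simp only [mul_one, Finset.sum_const, Finset.card_range, nsmul_eq_mul, Nat.cast_add,
    Nat.cast_one] at h
  rw [h]
  field_simp

theorem abs_score_le (i : Fin n) (S : Finset (Fin n)) : |score i S| ≤ 1 := by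
  unfold score
  have h1 : ((S.erase i).card : ℝ) ≤ n := by exact_mod_cast card_le_n _
  have h2 : (0 : ℝ) ≤ (((S.erase i).card : ℝ) + 1) / (n + 1) := by positivity
  have h3 : (((S.erase i).card : ℝ) + 1) / (n + 1) ≤ 1 := by
    rw [div_le_one (by positivity)]; linarith
  rw [abs_le]
  split_ifs <;> constructor <;> linarith

theorem sum_score (S : Finset (Fin n)) :
    ∑ i, score i S = (2 * S.card - n) / (n + 1) := by
  have h : ∀ i, score i S = (if i ∈ S then (1 : ℝ) + 1 / (n + 1) else 0)
      - ((S.card : ℝ) + 1) / (n + 1) := by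
    intro i
    unfold score
    split_ifs with hi
    · rw [Finset.card_erase_of_mem hi, Nat.cast_pred (Finset.card_pos.2 ⟨i, hi⟩)]
      field_simp
      ring
    · rw [Finset.erase_eq_of_notMem hi]
  simp only [h, Finset.sum_sub_distrib, Finset.sum_ite_mem, Finset.univ_inter,
    Finset.sum_const, Finset.card_univ, Fintype.card_fin, nsmul_eq_mul]
  field_simp
  ring

/-- This is Laplace's rule of succession: after `s` successes in the other `n - 1` trials, the
chance of success is `(s + 1) / (n + 1)`, so the score is centred given the other entries. -/
theorem priorWeight_mul_score_insert {i : Fin n} {S : Finset (Fin n)} (hi : i ∉ S) :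
    priorWeight (insert i S) * score i (insert i S) + priorWeight S * score i S = 0 := by
  unfold priorWeight score
  rw [Finset.card_insert_of_notMem hi, Finset.erase_insert hi, Finset.erase_eq_of_notMem hi]
  simp only [Finset.mem_insert_self, if_true, hi, if_false]
  have hlt : S.card < n := by
    have := card_le_n (insert i S)
    rw [Finset.card_insert_of_notMem hi] at this
    omega
  have h := Nat.choose_succ_right_eq n S.card
  have h' : (n.choose (S.card + 1) : ℝ) * (S.card + 1) = n.choose S.card * (n - S.card) := by
    rw [← Nat.cast_sub hlt.le]; exact_mod_cast h
  have h1 : (n.choose S.card : ℝ) ≠ 0 := by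
    have := Nat.choose_pos hlt.le; positivity
  have h2 : (n.choose (S.card + 1) : ℝ) ≠ 0 := by
    have := Nat.choose_pos (show S.card + 1 ≤ n from hlt); positivity
  field_simp
  linear_combination (-1 : ℝ) * h'

/-- Change of membership of `i`. -/
def toggle (i : Fin n) (S : Finset (Fin n)) : Finset (Fin n) :=
  if i ∈ S then S.erase i else insert i S

theorem toggle_toggle (i : Fin n) (S : Finset (Fin n)) : toggle i (toggle i S) = S := by
  unfold toggle
  by_cases h : i ∈ S <;> simp [h]

theorem toggle_ne (i : Fin n) (S : Finset (Fin n)) : toggle i S ≠ S := by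
  unfold toggle
  split_ifs with h
  · simp [h]
  · simp [h]

theorem erase_toggle (i : Fin n) (S : Finset (Fin n)) : (toggle i S).erase i = S.erase i := by
  unfold toggle
  split_ifs with h
  · simp
  · rw [Finset.erase_insert h, Finset.erase_eq_of_notMem h]

theorem priorWeight_mul_score_toggle (i : Fin n) (S : Finset (Fin n)) :
    priorWeight S * score i S + priorWeight (toggle i S) * score i (toggle i S) = 0 := by
  unfold toggle
  split_ifs with h
  · have := priorWeight_mul_score_insert (Finset.notMem_erase i S)
    rwa [Finset.insert_erase h] at this
  · rw [add_comm]; exact priorWeight_mul_score_insert h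

/-- The law of a matrix with independent columns, each distributed according to `priorWeight`. -/
noncomputable def matrixWeight (X : Fin d → Finset (Fin n)) : ℝ := ∏ j, priorWeight (X j)

theorem matrixWeight_nonneg (X : Fin d → Finset (Fin n)) : 0 ≤ matrixWeight X :=
  Finset.prod_nonneg fun _ _ => priorWeight_nonneg _

theorem sum_matrixWeight : ∑ X : Fin d → Finset (Fin n), matrixWeight X = 1 := by
  have h := Finset.prod_univ_sum (fun _ : Fin d => (Finset.univ : Finset (Finset (Fin n))))
    fun _ S => priorWeight S
  simp only [sum_priorWeight, Finset.prod_const_one, Fintype.piFinset_univ] at h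
  exact h.symm

theorem sum_matrixWeight_mul (j : Fin d) (F : Finset (Fin n) → ℝ) :
    ∑ X : Fin d → Finset (Fin n), matrixWeight X * F (X j) =
      ∑ S : Finset (Fin n), priorWeight S * F S := by
  have h := Finset.prod_univ_sum (fun _ : Fin d => (Finset.univ : Finset (Finset (Fin n))))
    fun j' S => priorWeight S * if j' = j then F S else 1
  simp only [Fintype.piFinset_univ, Finset.prod_mul_distrib, Finset.prod_ite_eq',
    Finset.mem_univ, if_true] at h
  unfold matrixWeight
  rw [← h, Finset.prod_eq_single j]
  · simp
  · intro j' _ hj'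
    simp [hj', sum_priorWeight]
  · simp

/-- The entry `(i, j)` has mean zero given the other entries. -/
theorem sum_matrixWeight_mul_score (i : Fin n) (j : Fin d) (H : (Fin d → Finset (Fin n)) → ℝ)
    (hH : ∀ X, H (Function.update X j (toggle i (X j))) = H X) :
    ∑ X : Fin d → Finset (Fin n), matrixWeight X * (score i (X j) * H X) = 0 := by
  -- Matrices differing only in the entry `(i, j)` cancel in pairs, as `H` does not see this entry.
  refine Finset.sum_involution (fun X _ => Function.update X j (toggle i (X j))) ?_ ?_ ?_ ?_
  · intro X _
    rw [hH]
    unfold matrixWeight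
    have h := Finset.prod_congr rfl fun j' (hj' : j' ∈ Finset.univ.erase j) =>
      congrArg priorWeight (Function.update_of_ne (Finset.ne_of_mem_erase hj') (toggle i (X j)) X)
    rw [← Finset.mul_prod_erase _ (fun j' => priorWeight (X j')) (Finset.mem_univ j),
      ← Finset.mul_prod_erase _ (fun j' => priorWeight (Function.update X j (toggle i (X j)) j'))
        (Finset.mem_univ j), h, Function.update_self]
    linear_combination (∏ j' ∈ Finset.univ.erase j, priorWeight (X j')) * H X *
      priorWeight_mul_score_toggle i (X j)
  · intro X _ _ h
    have := congrFun h j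
    rw [Function.update_self] at this
    exact toggle_ne _ _ this
  · simp
  · intro X _
    simp [toggle_toggle]

/-- A one-way marginal is correlated with the total score of its column. -/
theorem sum_priorWeight_mul_marginal (hn : 0 < n) :
    1 / 6 ≤ ∑ S : Finset (Fin n), priorWeight S *
      (((S.card : ℝ) / n - 1 / 2) * ((2 * S.card - n) / (n + 1))) := by
  rw [sum_priorWeight_mul fun k => ((k : ℝ) / n - 1 / 2) * ((2 * k - n) / (n + 1))]
  have hn' : (0 : ℝ) < n := by exact_mod_cast hn
  -- The upper limit is decoupled from `n` so that induction applies. At `m = n` the sum is `n (n +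
  -- 1) (n + 2) / 3`, and the correlation equals `(n + 2) / (6 (n + 1))`.
  have key : ∀ m : ℕ, ∑ k ∈ Finset.range (m + 1), (2 * (k : ℝ) - n) ^ 2 =
      (m + 1) * ((2 / 3) * m * (2 * m + 1) - 2 * n * m + (n : ℝ) ^ 2) := by
    intro m
    induction m with
    | zero => simp
    | succ m ih =>
      rw [Finset.sum_range_succ, ih]
      push_cast
      ring
  have h2 : ∑ k ∈ Finset.range (n + 1), ((k : ℝ) / n - 1 / 2) * ((2 * k - n) / (n + 1)) =
      (∑ k ∈ Finset.range (n + 1), (2 * (k : ℝ) - n) ^ 2) / (2 * n * (n + 1)) := by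
    rw [Finset.sum_div]
    refine Finset.sum_congr rfl fun k _ => ?_
    field_simp
  rw [h2, key, div_div, div_le_div_iff₀ (by norm_num) (by positivity)]
  nlinarith [mul_pos hn' hn', mul_pos (mul_pos hn' hn') hn']

end Prior

/-! ### Matrices as streams -/

section Encoding
variable {U : Type u} {T n d : ℕ}

/-- A change of the existence vector of `a` is caused by an entry pertaining to `a`. -/
theorem flip_le_ncard (x : Stream U T) (a : U) :
    flip a x ≤ {t : Fin T | x t = Entry.ins a ∨ x t = Entry.del a}.ncard := by
  unfold flip
  -- A change between `j` and `j + 1` is charged to the entry at `j + 1`; the value `j` past the end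
  -- is never used.
  refine Set.ncard_le_ncard_of_injOn
    (fun j => if h : j.1 + 1 < T then (⟨j.1 + 1, h⟩ : Fin T) else j) ?_ ?_ (Set.toFinite _)
  · rintro j ⟨h, hne⟩
    simp only [h, dif_pos, Set.mem_ofPred_eq]
    by_contra! hcon
    apply hne
    have key : ∀ e : Entry U, x ⟨j.1 + 1, h⟩ ≠ e →
        {s : Fin T | s ≤ j ∧ x s = e} = {s : Fin T | s ≤ ⟨j.1 + 1, h⟩ ∧ x s = e} := by
      intro e he
      ext s
      simp only [Set.mem_ofPred_eq, Fin.le_def]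
      refine ⟨fun hs => ⟨by omega, hs.2⟩, fun hs => ⟨?_, hs.2⟩⟩
      rcases Nat.lt_or_ge s.1 (j.1 + 1) with h1 | h1
      · omega
      · have : s = ⟨j.1 + 1, h⟩ := Fin.ext (le_antisymm hs.1 h1)
        exact absurd (this ▸ hs.2) he
    unfold existence insCount delCount
    rw [key _ hcon.1, key _ hcon.2]
  · rintro j ⟨h, -⟩ j' ⟨h', -⟩ heq
    simp only [h, h', dif_pos, Fin.mk.injEq] at heq
    exact Fin.ext (by omega)

open Classical in
/-- The stream encoding a binary matrix with columns `X j`: the `j`-th block of length `2 * n`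
inserts, and afterwards deletes, the elements of `X j`, where `i` owns the `i`-th and the
`(n + i)`-th time step of the block. -/
noncomputable def encode (e : Fin n → U) (X : Fin d → Finset (Fin n)) : Stream U T := fun t =>
  -- The remainder modulo `2 * n` recovers the owner of the step, so the `noop` of the inner test is
  -- never reached.
  if ∃ j i, i ∈ X j ∧ t.1 = 2 * n * j.1 + i.1 then
    if h : t.1 % (2 * n) < n then Entry.ins (e ⟨t.1 % (2 * n), h⟩) else Entry.noop
  else if ∃ j i, i ∈ X j ∧ t.1 = 2 * n * j.1 + n + i.1 then
    if h : t.1 % (2 * n) - n < n then Entry.del (e ⟨t.1 % (2 * n) - n, h⟩) else Entry.noop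
  else Entry.noop

theorem slot_mod (j i : ℕ) (hi : i < n) : (2 * n * j + i) % (2 * n) = i := by
  rw [Nat.mul_add_mod, Nat.mod_eq_of_lt (by omega)]

theorem slot_mod' (j i : ℕ) (hi : i < n) : (2 * n * j + n + i) % (2 * n) = n + i := by
  rw [add_assoc, Nat.mul_add_mod, Nat.mod_eq_of_lt (by omega)]

theorem slot_inj {j j' i : ℕ} (hn : 0 < n) (h : 2 * n * j + i = 2 * n * j' + i) : j = j' :=
  Nat.eq_of_mul_eq_mul_left (show 0 < 2 * n by omega) (by omega)

theorem encode_eq_ins (e : Fin n ↪ U) (X : Fin d → Finset (Fin n)) (t : Fin T) (i : Fin n) :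
    encode e X t = Entry.ins (e i) ↔ ∃ j, i ∈ X j ∧ t.1 = 2 * n * j.1 + i.1 := by
  unfold encode
  split_ifs with h1 h2 h3 h4
  · obtain ⟨j, i', hi', ht⟩ := h1
    have hm : t.1 % (2 * n) = i'.1 := by rw [ht, slot_mod _ _ i'.2]
    constructor
    · intro h
      have h' := e.injective (Entry.ins.inj h)
      have : i' = i := by rw [← h']; exact Fin.ext hm.symm
      exact ⟨j, this ▸ hi', this ▸ ht⟩
    · rintro ⟨j', hi, ht'⟩
      congr 2
      exact Fin.ext (by simp only [ht', slot_mod _ _ i.2])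
  · obtain ⟨j, i', hi', ht⟩ := h1
    exact absurd (by rw [ht, slot_mod _ _ i'.2]; exact i'.2) h2
  all_goals
    refine iff_of_false (by simp) ?_
    rintro ⟨j, hj⟩
    exact h1 ⟨j, i, hj⟩

theorem encode_eq_del (e : Fin n ↪ U) (X : Fin d → Finset (Fin n)) (t : Fin T) (i : Fin n) :
    encode e X t = Entry.del (e i) ↔ ∃ j, i ∈ X j ∧ t.1 = 2 * n * j.1 + n + i.1 := by
  unfold encode
  split_ifs with h1 h2 h3 h4
  · simp only [false_iff]
    rintro ⟨j, hj, ht⟩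
    rw [ht, slot_mod' _ _ i.2] at h2
    omega
  · obtain ⟨j, i', hi', ht⟩ := h1
    exact absurd (by rw [ht, slot_mod _ _ i'.2]; exact i'.2) h2
  · obtain ⟨j, i', hi', ht⟩ := h3
    have hm : t.1 % (2 * n) - n = i'.1 := by rw [ht, slot_mod' _ _ i'.2]; omega
    constructor
    · intro h
      have h' := e.injective (Entry.del.inj h)
      have : i' = i := by rw [← h']; exact Fin.ext hm.symm
      exact ⟨j, this ▸ hi', this ▸ ht⟩
    · rintro ⟨j', hi, ht'⟩
      congr 2
      exact Fin.ext (by simp only [ht', slot_mod' _ _ i.2]; omega)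
  · obtain ⟨j, i', hi', ht⟩ := h3
    exact absurd (by rw [ht, slot_mod' _ _ i'.2]; omega) h4
  · simp only [false_iff]
    rintro ⟨j, hj⟩
    exact h3 ⟨j, i, hj⟩

theorem encode_cases (e : Fin n → U) (X : Fin d → Finset (Fin n)) (t : Fin T) :
    encode e X t = Entry.noop ∨ (∃ i, encode e X t = Entry.ins (e i)) ∨
      ∃ i, encode e X t = Entry.del (e i) := by
  unfold encode
  split_ifs <;> simp

/-- Time steps are assigned to elements independently of the matrix, so a change of row `i` leaves
the steps of all other elements in place. -/
theorem erasesItem_encode (e : Fin n ↪ U) (X : Fin d → Finset (Fin n)) (i : Fin n) :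
    ErasesItem (e i) (encode e X : Stream U T) (encode e fun j => (X j).erase i) := by
  intro t
  by_cases h : encode e X t = Entry.ins (e i) ∨ encode e X t = Entry.del (e i)
  · right
    refine ⟨?_, h⟩
    rcases encode_cases e (fun j => (X j).erase i) t with h0 | ⟨i', h0⟩ | ⟨i', h0⟩
    · exact h0
    · obtain ⟨j', hj', ht'⟩ := (encode_eq_ins e _ t i').1 h0
      rw [Finset.mem_erase] at hj'
      have := (encode_eq_ins e X t i').2 ⟨j', hj'.2, ht'⟩
      rw [this] at h
      simp only [Entry.ins.injEq, e.injective.eq_iff, reduceCtorEq, or_false] at h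
      exact absurd h hj'.1
    · obtain ⟨j', hj', ht'⟩ := (encode_eq_del e _ t i').1 h0
      rw [Finset.mem_erase] at hj'
      have := (encode_eq_del e X t i').2 ⟨j', hj'.2, ht'⟩
      rw [this] at h
      simp only [Entry.del.injEq, e.injective.eq_iff, reduceCtorEq, false_or] at h
      exact absurd h hj'.1
  · left
    push Not at h
    rcases encode_cases e X t with h0 | ⟨i', h0⟩ | ⟨i', h0⟩
    · rcases encode_cases e (fun j => (X j).erase i) t with h1 | ⟨i', h1⟩ | ⟨i', h1⟩
      · rw [h0, h1]
      · obtain ⟨j', hj', ht'⟩ := (encode_eq_ins e _ t i').1 h1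
        rw [(encode_eq_ins e X t i').2 ⟨j', Finset.mem_of_mem_erase hj', ht'⟩] at h0
        cases h0
      · obtain ⟨j', hj', ht'⟩ := (encode_eq_del e _ t i').1 h1
        rw [(encode_eq_del e X t i').2 ⟨j', Finset.mem_of_mem_erase hj', ht'⟩] at h0
        cases h0
    · obtain ⟨j', hj', ht'⟩ := (encode_eq_ins e _ t i').1 h0
      rw [h0, encode_eq_ins]
      refine ⟨j', Finset.mem_erase.2 ⟨?_, hj'⟩, ht'⟩
      rintro rfl
      exact h.1 h0
    · obtain ⟨j', hj', ht'⟩ := (encode_eq_del e _ t i').1 h0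
      rw [h0, encode_eq_del]
      refine ⟨j', Finset.mem_erase.2 ⟨?_, hj'⟩, ht'⟩
      rintro rfl
      exact h.2 h0

/-- An element of the range of `e` owns two steps per block, and any other element owns none. -/
theorem maxFlippancy_encode (e : Fin n ↪ U) (X : Fin d → Finset (Fin n)) :
    maxFlippancy (encode e X : Stream U T) ≤ 2 * d := by
  refine ciSup_le' fun a => (flip_le_ncard _ a).trans ?_
  by_cases ha : ∃ i, e i = a
  · obtain ⟨i, rfl⟩ := ha
    calc _ ≤ ((fun p : Fin d × Bool => 2 * n * p.1.1 + (if p.2 then n else 0) + i.1) ''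
          Set.univ).ncard := by
          refine Set.ncard_le_ncard_of_injOn (fun t : Fin T => t.1) ?_
            (fun _ _ _ _ h => Fin.ext h) (Set.toFinite _)
          rintro t (ht | ht)
          · obtain ⟨j, -, hj⟩ := (encode_eq_ins e X t i).1 ht
            exact ⟨(j, false), trivial, by simp [hj]⟩
          · obtain ⟨j, -, hj⟩ := (encode_eq_del e X t i).1 ht
            exact ⟨(j, true), trivial, by simp [hj]⟩
      _ ≤ (Set.univ : Set (Fin d × Bool)).ncard := Set.ncard_image_le
      _ = 2 * d := by simp [Set.ncard_univ, mul_comm]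
  · push Not at ha
    have : {t : Fin T | encode e X t = Entry.ins a ∨ encode e X t = Entry.del a} = ∅ := by
      ext t
      simp only [Set.mem_ofPred_eq, Set.mem_empty_iff_false, iff_false]
      rcases encode_cases e X t with h | ⟨i, h⟩ | ⟨i, h⟩
      · simp [h]
      · simp [h, ha i]
      · simp [h, ha i]
    simp [this]

/-- The last insertion step of the `j`-th block. -/
def queryTime (hn : 0 < n) (hT : 2 * n * d ≤ T) (j : Fin d) : Fin T :=
  ⟨2 * n * j.1 + (n - 1), by
    have : 2 * n * (j.1 + 1) ≤ 2 * n * d := Nat.mul_le_mul_left _ j.2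
    rw [mul_add, mul_one] at this
    omega⟩

theorem insCount_encode (e : Fin n ↪ U) (X : Fin d → Finset (Fin n)) (hn : 0 < n)
    (hT : 2 * n * d ≤ T) (j : Fin d) (i : Fin n) :
    insCount (encode e X) (e i) (queryTime hn hT j) =
      {j' : Fin d | j' ≤ j ∧ i ∈ X j'}.ncard := by
  unfold insCount
  have hlt : ∀ j' : Fin d, 2 * n * j'.1 + i.1 < T := fun j' => by
    have : 2 * n * (j'.1 + 1) ≤ 2 * n * d := Nat.mul_le_mul_left _ j'.2
    rw [mul_add, mul_one] at this
    omega
  have hset : {s : Fin T | s ≤ queryTime hn hT j ∧ encode e X s = Entry.ins (e i)} =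
      (fun j' : Fin d => (⟨2 * n * j'.1 + i.1, hlt j'⟩ : Fin T)) ''
        {j' : Fin d | j' ≤ j ∧ i ∈ X j'} := by
    ext s
    simp only [Set.mem_ofPred_eq, encode_eq_ins, Set.mem_image, Fin.le_def, queryTime]
    constructor
    · rintro ⟨hs, j', hi, hj'⟩
      refine ⟨j', ⟨?_, hi⟩, Fin.ext hj'.symm⟩
      by_contra! hlt
      have : 2 * n * (j.1 + 1) ≤ 2 * n * j'.1 := Nat.mul_le_mul_left _ hlt
      rw [mul_add, mul_one] at this
      omega
    · rintro ⟨j', ⟨hj', hi⟩, rfl⟩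
      have : 2 * n * j'.1 ≤ 2 * n * j.1 := Nat.mul_le_mul_left _ hj'
      exact ⟨by dsimp only; omega, j', hi, rfl⟩
  rw [hset, Set.ncard_image_of_injective]
  intro j1 j2 h
  exact Fin.ext (slot_inj hn (Fin.mk.inj_iff.1 h))

/-- The query precedes the deletions of its own block, hence the strict inequality, in contrast to
`insCount_encode`. -/
theorem delCount_encode (e : Fin n ↪ U) (X : Fin d → Finset (Fin n)) (hn : 0 < n)
    (hT : 2 * n * d ≤ T) (j : Fin d) (i : Fin n) :
    delCount (encode e X) (e i) (queryTime hn hT j) =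
      {j' : Fin d | j' < j ∧ i ∈ X j'}.ncard := by
  unfold delCount
  have hlt : ∀ j' : Fin d, 2 * n * j'.1 + n + i.1 < T := fun j' => by
    have : 2 * n * (j'.1 + 1) ≤ 2 * n * d := Nat.mul_le_mul_left _ j'.2
    rw [mul_add, mul_one] at this
    omega
  have hset : {s : Fin T | s ≤ queryTime hn hT j ∧ encode e X s = Entry.del (e i)} =
      (fun j' : Fin d => (⟨2 * n * j'.1 + n + i.1, hlt j'⟩ : Fin T)) ''
        {j' : Fin d | j' < j ∧ i ∈ X j'} := by
    ext s
    simp only [Set.mem_ofPred_eq, encode_eq_del, Set.mem_image, Fin.le_def, Fin.lt_def, queryTime]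
    constructor
    · rintro ⟨hs, j', hi, hj'⟩
      refine ⟨j', ⟨?_, hi⟩, Fin.ext hj'.symm⟩
      by_contra! hlt
      have : 2 * n * j.1 ≤ 2 * n * j'.1 := Nat.mul_le_mul_left _ hlt
      omega
    · rintro ⟨j', ⟨hj', hi⟩, rfl⟩
      have : 2 * n * (j'.1 + 1) ≤ 2 * n * j.1 := Nat.mul_le_mul_left _ hj'
      rw [mul_add, mul_one] at this
      exact ⟨by dsimp only; omega, j', hi, rfl⟩
  rw [hset, Set.ncard_image_of_injective]
  intro j1 j2 h
  have := Fin.mk.inj_iff.1 h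
  exact Fin.ext (slot_inj (i := i.1) hn (by omega))

theorem existence_encode (e : Fin n ↪ U) (X : Fin d → Finset (Fin n)) (hn : 0 < n)
    (hT : 2 * n * d ≤ T) (j : Fin d) (i : Fin n) :
    existence (encode e X) (e i) (queryTime hn hT j) = if i ∈ X j then 1 else 0 := by
  unfold existence
  rw [insCount_encode, delCount_encode]
  by_cases hi : i ∈ X j
  · rw [if_pos hi, if_pos]
    refine Set.ncard_lt_ncard ⟨fun j' h => ⟨h.1.le, h.2⟩, fun h => ?_⟩ (Set.toFinite _)
    exact lt_irrefl j (h ⟨le_rfl, hi⟩ : j < j ∧ i ∈ X j).1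
  · rw [if_neg hi, if_neg]
    rw [not_lt]
    refine Set.ncard_le_ncard (fun j' h => ⟨lt_of_le_of_ne h.1 ?_, h.2⟩) (Set.toFinite _)
    rintro rfl
    exact hi h.2

theorem countDistinct_encode (e : Fin n ↪ U) (X : Fin d → Finset (Fin n)) (hn : 0 < n)
    (hT : 2 * n * d ≤ T) (j : Fin d) :
    countDistinct (encode e X) (queryTime hn hT j) = (X j).card := by
  unfold countDistinct
  rw [finsum_eq_sum_of_support_subset (s := Finset.univ.map e), Finset.sum_map]
  · simp [existence_encode]
  · intro a ha
    simp only [Finset.coe_map, Finset.coe_univ, Set.image_univ]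
    by_contra hcon
    apply ha
    have : insCount (encode e X) a (queryTime hn hT j) = 0 := by
      unfold insCount
      rw [Set.ncard_eq_zero]
      ext t
      simp only [Set.mem_ofPred_eq, Set.mem_empty_iff_false, iff_false, not_and]
      intro _ h
      rcases encode_cases e X t with h' | ⟨i, h'⟩ | ⟨i, h'⟩
      · rw [h'] at h; cases h
      · rw [h'] at h; exact hcon ⟨i, Entry.ins.inj h⟩
      · rw [h'] at h; cases h
    simp [existence, this]

end Encoding

/-! ### Fingerprinting bound for marginals under approximate privacy -/

section Marginals
variable {n d : ℕ} {Ω : Type*}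

/-- The matrix with columns `X j` with the `i`-th row set to zero. -/
def eraseRow (i : Fin n) (X : Fin d → Finset (Fin n)) : Fin d → Finset (Fin n) :=
  fun j => (X j).erase i

/-- This supplies the invariance required by `sum_matrixWeight_mul_score` for anything computed from
the answers on the erased matrix. -/
theorem eraseRow_update_toggle (i : Fin n) (j : Fin d) (X : Fin d → Finset (Fin n)) :
    eraseRow i (Function.update X j (toggle i (X j))) = eraseRow i X := by
  funext j'
  unfold eraseRow
  by_cases h : j' = j
  · subst h; rw [Function.update_self, erase_toggle]
  · rw [Function.update_of_ne h]

/-- The correlation of the answers `q` with the `i`-th row of a matrix. -/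
noncomputable def correlation (q : Fin d → Ω → ℝ) (i : Fin n) (X : Fin d → Finset (Fin n)) (r : Ω) : ℝ :=
  ∑ j, score i (X j) * q j r

theorem abs_correlation_le {q : Fin d → Ω → ℝ} (hb : ∀ j r, |q j r| ≤ 1) (i : Fin n)
    (X : Fin d → Finset (Fin n)) (r : Ω) : |correlation q i X r| ≤ d := by
  calc |correlation q i X r| ≤ ∑ j, |score i (X j) * q j r| := Finset.abs_sum_le_sum_abs _ _
    _ ≤ ∑ _j : Fin d, (1 : ℝ) := Finset.sum_le_sum fun j _ => by
        rw [abs_mul]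
        exact mul_le_one₀ (abs_score_le _ _) (abs_nonneg _) (hb j r)
    _ = d := by simp

theorem sum_correlation (q : Fin d → Ω → ℝ) (X : Fin d → Finset (Fin n)) (r : Ω) :
    ∑ i, correlation q i X r = ∑ j, (2 * ((X j).card : ℝ) - n) / (n + 1) * q j r := by
  unfold correlation
  rw [Finset.sum_comm]
  simp only [← Finset.sum_mul, sum_score]

variable [MeasurableSpace Ω]

theorem measurable_correlation {q : Fin d → Ω → ℝ} (hq : ∀ j, Measurable (q j)) (i : Fin n)
    (X : Fin d → Finset (Fin n)) : Measurable (correlation q i X) :=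
  Finset.measurable_sum _ fun j _ => (hq j).const_mul _

theorem integrable_of_abs_le {μ : Measure Ω} [IsFiniteMeasure μ] {f : Ω → ℝ} {B : ℝ}
    (hf : Measurable f) (hB : ∀ r, |f r| ≤ B) : Integrable f μ :=
  Integrable.of_bound hf.aestronglyMeasurable B (ae_of_all _ hB)

variable (P : (Fin d → Finset (Fin n)) → Measure Ω) [∀ X, IsProbabilityMeasure (P X)]

theorem sum_integral_correlation_eraseRow {q : Fin d → Ω → ℝ} (hq : ∀ j, Measurable (q j))
    (hb : ∀ j r, |q j r| ≤ 1) (i : Fin n) :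
    ∑ X, matrixWeight X * ∫ r, correlation q i X r ∂P (eraseRow i X) = 0 := by
  have h : ∀ X, ∫ r, correlation q i X r ∂P (eraseRow i X) =
      ∑ j, score i (X j) * ∫ r, q j r ∂P (eraseRow i X) := by
    intro X
    unfold correlation
    rw [integral_finsetSum _ fun j _ => (integrable_of_abs_le (hq j) (hb j)).const_mul _]
    simp only [integral_const_mul]
  simp only [h, Finset.mul_sum]
  rw [Finset.sum_comm]
  refine Finset.sum_eq_zero fun j _ => ?_
  refine sum_matrixWeight_mul_score i j (fun X => ∫ r, q j r ∂P (eraseRow i X)) fun X => ?_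
  simp only [eraseRow_update_toggle]

/-- When the square is expanded, the off-diagonal terms vanish because `score i (X j)` is centred
given the other columns and the erased matrix; each of the `d` diagonal terms is at most `1`. -/
theorem sum_integral_correlation_sq_eraseRow {q : Fin d → Ω → ℝ} (hq : ∀ j, Measurable (q j))
    (hb : ∀ j r, |q j r| ≤ 1) (i : Fin n) :
    ∑ X, matrixWeight X * ∫ r, correlation q i X r ^ 2 ∂P (eraseRow i X) ≤ d := by
  have hbb : ∀ j j' r, |q j r * q j' r| ≤ 1 := fun j j' r => by
    rw [abs_mul]
    exact mul_le_one₀ (hb j r) (abs_nonneg _) (hb j' r)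
  have hint : ∀ j j' X, Integrable (fun r => q j r * q j' r) (P X) := fun j j' X =>
    integrable_of_abs_le ((hq j).mul (hq j')) (hbb j j')
  have h : ∀ X, ∫ r, correlation q i X r ^ 2 ∂P (eraseRow i X) =
      ∑ j, ∑ j', score i (X j) * (score i (X j') * ∫ r, q j r * q j' r ∂P (eraseRow i X)) := by
    intro X
    have : ∀ r, correlation q i X r ^ 2 =
        ∑ j, ∑ j', (score i (X j) * score i (X j')) * (q j r * q j' r) := by
      intro r
      unfold correlation
      rw [sq, Finset.sum_mul_sum]
      exact Finset.sum_congr rfl fun j _ => Finset.sum_congr rfl fun j' _ => by ring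
    simp only [this]
    rw [integral_finsetSum _ fun j _ => integrable_finsetSum _ fun j' _ =>
      (hint j j' _).const_mul _]
    refine Finset.sum_congr rfl fun j _ => ?_
    rw [integral_finsetSum _ fun j' _ => (hint j j' _).const_mul _]
    refine Finset.sum_congr rfl fun j' _ => ?_
    rw [integral_const_mul, mul_assoc]
  simp only [h, Finset.mul_sum]
  rw [Finset.sum_comm]
  have hd : (d : ℝ) = ∑ _j : Fin d, (1 : ℝ) := by simp
  rw [hd]
  refine Finset.sum_le_sum fun j _ => ?_
  rw [Finset.sum_comm, Finset.sum_eq_single j]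
  · rw [← sum_matrixWeight (n := n) (d := d)]
    refine Finset.sum_le_sum fun X _ => mul_le_of_le_one_right (matrixWeight_nonneg X) ?_
    have h1 : |∫ r, q j r * q j r ∂P (eraseRow i X)| ≤ 1 := by
      have := norm_integral_le_of_norm_le_const (μ := P (eraseRow i X))
        (f := fun r => q j r * q j r) (C := 1) (ae_of_all _ (hbb j j))
      simpa using this
    refine (le_abs_self _).trans ?_
    rw [abs_mul, abs_mul]
    exact mul_le_one₀ (abs_score_le _ _) (by positivity)
      (mul_le_one₀ (abs_score_le _ _) (abs_nonneg _) h1)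
  · intro j' _ hj'
    refine sum_matrixWeight_mul_score i j
      (fun X => score i (X j') * ∫ r, q j r * q j' r ∂P (eraseRow i X)) fun X => ?_
    simp only [eraseRow_update_toggle, Function.update_of_ne hj']
  · simp

theorem sum_integral_abs_correlation_eraseRow (hd : 0 < d) {q : Fin d → Ω → ℝ}
    (hq : ∀ j, Measurable (q j)) (hb : ∀ j r, |q j r| ≤ 1) (i : Fin n) :
    ∑ X, matrixWeight X * ∫ r, |correlation q i X r| ∂P (eraseRow i X) ≤ Real.sqrt d := by
  have hs : 0 < Real.sqrt d := Real.sqrt_pos.2 (by exact_mod_cast hd)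
  have hss : Real.sqrt d * Real.sqrt d = d := Real.mul_self_sqrt (by positivity)
  have hsq := sum_integral_correlation_sq_eraseRow P hq hb i
  -- The bound `|c| ≤ c² / (2√d) + √d / 2` takes the place of Cauchy–Schwarz for the joint law of
  -- matrix and answers.
  have hX : ∀ X, ∫ r, |correlation q i X r| ∂P (eraseRow i X) ≤
      (∫ r, correlation q i X r ^ 2 ∂P (eraseRow i X)) * (2 * Real.sqrt d)⁻¹ + Real.sqrt d / 2 := by
    intro X
    have hm := measurable_correlation hq i X
    have hint : Integrable (fun r => correlation q i X r ^ 2) (P (eraseRow i X)) :=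
      integrable_of_abs_le (B := (d : ℝ) ^ 2) (hm.pow_const 2) fun r => by
        rw [abs_pow]; exact pow_le_pow_left₀ (abs_nonneg _) (abs_correlation_le hb i X r) 2
    calc ∫ r, |correlation q i X r| ∂P (eraseRow i X)
        ≤ ∫ r, (correlation q i X r ^ 2 * (2 * Real.sqrt d)⁻¹ + Real.sqrt d / 2) ∂P (eraseRow i X) := by
          refine integral_mono (integrable_of_abs_le hm (abs_correlation_le hb i X)).abs
            ((hint.mul_const _).add (integrable_const _)) fun r => ?_
          have : |correlation q i X r| * (2 * Real.sqrt d) ≤ correlation q i X r ^ 2 + d := by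
            rw [← sq_abs (correlation q i X r)]
            nlinarith [sq_nonneg (|correlation q i X r| - Real.sqrt d)]
          dsimp only
          field_simp
          nlinarith
      _ = _ := by
          rw [integral_add (hint.mul_const _) (integrable_const _), integral_mul_const]
          simp
  calc ∑ X, matrixWeight X * ∫ r, |correlation q i X r| ∂P (eraseRow i X)
      ≤ ∑ X, ((matrixWeight X * ∫ r, correlation q i X r ^ 2 ∂P (eraseRow i X)) * (2 * Real.sqrt d)⁻¹
          + matrixWeight X * (Real.sqrt d / 2)) := by
        refine Finset.sum_le_sum fun X _ => ?_
        have := mul_le_mul_of_nonneg_left (hX X) (matrixWeight_nonneg X)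
        linarith
    _ = (∑ X, matrixWeight X * ∫ r, correlation q i X r ^ 2 ∂P (eraseRow i X)) * (2 * Real.sqrt d)⁻¹
          + Real.sqrt d / 2 := by
        rw [Finset.sum_add_distrib, ← Finset.sum_mul, ← Finset.sum_mul, sum_matrixWeight, one_mul]
    _ ≤ d * (2 * Real.sqrt d)⁻¹ + Real.sqrt d / 2 := by gcongr
    _ = Real.sqrt d := by
        field_simp
        rw [sq, hss]
        ring

/-- Differential privacy bounds the expected total correlation of the answers with the rows. -/
theorem sum_integral_correlation_le (hd : 0 < d) {ε δ : ℝ} (hε : 0 ≤ ε) (hε1 : ε ≤ 1) (hδ : 0 ≤ δ)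
    (hDP : ∀ X i S, MeasurableSet S →
      P X S ≤ ENNReal.ofReal (Real.exp ε) * P (eraseRow i X) S + ENNReal.ofReal δ)
    (hDP' : ∀ X i S, MeasurableSet S →
      P (eraseRow i X) S ≤ ENNReal.ofReal (Real.exp ε) * P X S + ENNReal.ofReal δ)
    {q : Fin d → Ω → ℝ} (hq : ∀ j, Measurable (q j)) (hb : ∀ j r, |q j r| ≤ 1) (i : Fin n) :
    ∑ X, matrixWeight X * ∫ r, correlation q i X r ∂P X ≤ 2 * ε * Real.sqrt d + 2 * δ * d := by
  calc ∑ X, matrixWeight X * ∫ r, correlation q i X r ∂P X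
      ≤ ∑ X, (matrixWeight X * (∫ r, correlation q i X r ∂P (eraseRow i X))
          + 2 * ε * (matrixWeight X * ∫ r, |correlation q i X r| ∂P (eraseRow i X))
          + matrixWeight X * (2 * δ * d)) := by
        refine Finset.sum_le_sum fun X _ => ?_
        have := mul_le_mul_of_nonneg_left (integral_le_integral_add hε hε1 hδ (hDP X i) (hDP' X i)
          (measurable_correlation hq i X) (abs_correlation_le hb i X) d.cast_nonneg) (matrixWeight_nonneg X)
        linarith
    _ = 2 * ε * (∑ X, matrixWeight X * ∫ r, |correlation q i X r| ∂P (eraseRow i X)) + 2 * δ * d := by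
        rw [Finset.sum_add_distrib, Finset.sum_add_distrib, ← Finset.mul_sum, ← Finset.sum_mul,
          sum_matrixWeight, sum_integral_correlation_eraseRow P hq hb i]
        ring
    _ ≤ _ := by
        have := sum_integral_abs_correlation_eraseRow P hd hq hb i
        gcongr

/-- Accurate answers are correlated with the rows. -/
theorem le_integral_sum_correlation (hn : 0 < n) {q : Fin d → Ω → ℝ} (hq : ∀ j, Measurable (q j))
    (hb : ∀ j r, |q j r| ≤ 1 / 2) {β : ℝ} (hβ : 0 ≤ β) (X : Fin d → Finset (Fin n)) {G : Set Ω}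
    (hG : MeasurableSet G) (hPG : 0.99 ≤ (P X).real G)
    (hacc : ∀ r ∈ G, ∀ j, |q j r - ((X j).card / n - 1 / 2)| ≤ β) :
    ∑ j, ((X j).card / n - 1 / 2) * ((2 * ((X j).card : ℝ) - n) / (n + 1)) - d * (β + 1 / 100) ≤
      ∫ r, ∑ i, correlation q i X r ∂P X := by
  have hb1 : ∀ j r, |q j r| ≤ 1 := fun j r => (hb j r).trans (by norm_num)
  have hn' : (0 : ℝ) < n := by exact_mod_cast hn
  have hint : Integrable (fun r => ∑ i, correlation q i X r) (P X) :=
    integrable_finsetSum _ fun i _ =>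
      integrable_of_abs_le (measurable_correlation hq i X) (abs_correlation_le hb1 i X)
  have hbad : (P X).real Gᶜ ≤ 1 / 100 := by
    rw [probReal_compl_eq_one_sub hG]; linarith
  set t : Fin d → ℝ := fun j => (X j).card / n - 1 / 2 with ht
  have htb : ∀ j, |t j| ≤ 1 / 2 := fun j => by
    have h1 : ((X j).card : ℝ) / n ≤ 1 := by
      rw [div_le_one hn']; exact_mod_cast card_le_n _
    have h2 : (0 : ℝ) ≤ ((X j).card : ℝ) / n := by positivity
    rw [abs_le]; constructor <;> simp only [ht] <;> linarith
  have hg : ∀ j, |(2 * ((X j).card : ℝ) - n) / (n + 1)| ≤ 1 := fun j => by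
    have h1 : ((X j).card : ℝ) ≤ n := by exact_mod_cast card_le_n _
    have h2 : (0 : ℝ) ≤ (X j).card := by positivity
    rw [abs_div, abs_of_pos (show (0 : ℝ) < n + 1 by positivity), div_le_one (by positivity),
      abs_le]
    constructor <;> linarith
  -- Off `G` the deviation is still at most `1`, as answer and target both lie in `[-1/2, 1/2]`.
  have hterm : ∀ r j, ((t j) * ((2 * ((X j).card : ℝ) - n) / (n + 1))) -
      (β + Gᶜ.indicator (fun _ => (1 : ℝ)) r) ≤ (2 * ((X j).card : ℝ) - n) / (n + 1) * q j r := by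
    intro r j
    have hdiff : |q j r - t j| ≤ β + Gᶜ.indicator (fun _ => (1 : ℝ)) r := by
      by_cases hr : r ∈ G
      · rw [Set.indicator_of_notMem (by simpa using hr), add_zero]
        exact hacc r hr j
      · rw [Set.indicator_of_mem (by simpa using hr)]
        have := abs_sub (q j r) (t j)
        have := hb j r
        have := htb j
        linarith
    have h1 : |(2 * ((X j).card : ℝ) - n) / (n + 1) * (q j r - t j)| ≤
        β + Gᶜ.indicator (fun _ => (1 : ℝ)) r := by
      rw [abs_mul]
      exact (mul_le_of_le_one_left (abs_nonneg _) (hg j)).trans hdiff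
    have := (abs_le.1 h1).1
    linarith
  have hind : Integrable (Gᶜ.indicator fun _ => (1 : ℝ)) (P X) :=
    (integrable_const (1 : ℝ)).indicator hG.compl
  calc _ ≤ ∑ j, t j * ((2 * ((X j).card : ℝ) - n) / (n + 1)) - d * β
        - d * (P X).real Gᶜ := by
        have := mul_le_mul_of_nonneg_left hbad d.cast_nonneg
        linarith
    _ = ∫ r, ((∑ j, t j * ((2 * ((X j).card : ℝ) - n) / (n + 1)) - d * β)
          - d * Gᶜ.indicator (fun _ => (1 : ℝ)) r) ∂P X := by
        rw [integral_sub (integrable_const _) (hind.const_mul _), integral_const_mul,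
          integral_indicator_const _ hG.compl]
        simp
    _ ≤ _ := by
        refine integral_mono ((integrable_const _).sub (hind.const_mul _)) hint fun r => ?_
        dsimp only
        rw [sum_correlation]
        have := Finset.sum_le_sum fun j (_ : j ∈ Finset.univ) => hterm r j
        rw [Finset.sum_sub_distrib, Finset.sum_const, Finset.card_univ, Fintype.card_fin,
          nsmul_eq_mul] at this
        linarith

theorem abs_clamp_sub_le {y t β : ℝ} (ht : |t| ≤ 1 / 2) (hy : |y - t| ≤ β) :
    |max (-(1 / 2)) (min (1 / 2) y) - t| ≤ β := by
  rw [abs_le] at *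
  rcases max_cases (-(1 / 2)) (min (1 / 2) y) with h | h <;>
    rcases min_cases (1 / 2) y with h' | h' <;> constructor <;> linarith

theorem abs_clamp_le (y : ℝ) : |max (-(1 / 2)) (min (1 / 2) y)| ≤ 1 / 2 := by
  rw [abs_le]
  exact ⟨le_max_left _ _, max_le (by norm_num) (min_le_left _ _)⟩

/-- The error of approximately differentially private answers to one-way marginal queries. -/
theorem marginals_lower_bound (hn : 0 < n) (hd : 0 < d) {ε δ α : ℝ} (hε : 0 ≤ ε) (hε1 : ε ≤ 1)
    (hδ : 0 ≤ δ) (hnε : 80 * n * ε ≤ Real.sqrt d) (hnδ : 80 * n * δ ≤ 1)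
    (hDP : ∀ X i S, MeasurableSet S →
      P X S ≤ ENNReal.ofReal (Real.exp ε) * P (eraseRow i X) S + ENNReal.ofReal δ)
    (hDP' : ∀ X i S, MeasurableSet S →
      P (eraseRow i X) S ≤ ENNReal.ofReal (Real.exp ε) * P X S + ENNReal.ofReal δ)
    {a : Fin d → Ω → ℝ} (ha : ∀ j, Measurable (a j))
    (hacc : ∀ X, ENNReal.ofReal 0.99 ≤ P X {r | ∀ j, |((X j).card : ℝ) - a j r| ≤ α}) :
    (n : ℝ) / 20 ≤ α := by
  by_contra! hlt
  have hn' : (0 : ℝ) < n := by exact_mod_cast hn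
  have hd' : (0 : ℝ) < d := by exact_mod_cast hd
  -- Clamping to the range of the true marginals costs no accuracy and makes the answers bounded.
  let q : Fin d → Ω → ℝ := fun j r => max (-(1 / 2)) (min (1 / 2) (a j r / n - 1 / 2))
  have hq : ∀ j, Measurable (q j) := fun j =>
    measurable_const.max (measurable_const.min (((ha j).div_const _).sub_const _))
  have hb : ∀ j r, |q j r| ≤ 1 / 2 := fun j r => abs_clamp_le _
  have hb1 : ∀ j r, |q j r| ≤ 1 := fun j r => (hb j r).trans (by norm_num)
  have hupper : ∑ X, matrixWeight X * ∫ r, ∑ i, correlation q i X r ∂P X ≤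
      n * (2 * ε * Real.sqrt d + 2 * δ * d) := by
    have h1 : ∀ X, ∫ r, ∑ i, correlation q i X r ∂P X = ∑ i, ∫ r, correlation q i X r ∂P X := fun X =>
      integral_finsetSum _ fun i _ =>
        integrable_of_abs_le (measurable_correlation hq i X) (abs_correlation_le hb1 i X)
    simp only [h1, Finset.mul_sum]
    rw [Finset.sum_comm]
    calc _ ≤ ∑ _i : Fin n, (2 * ε * Real.sqrt d + 2 * δ * d) :=
          Finset.sum_le_sum fun i _ => sum_integral_correlation_le P hd hε hε1 hδ hDP hDP' hq hb1 i
      _ = _ := by simp [mul_add]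
  have hlower : ∀ X, ∑ j, ((X j).card / n - 1 / 2) * ((2 * ((X j).card : ℝ) - n) / (n + 1))
      - d * (1 / 20 + 1 / 100) ≤ ∫ r, ∑ i, correlation q i X r ∂P X := by
    intro X
    refine le_integral_sum_correlation P hn hq hb (by norm_num) X
      (G := {r | ∀ j, |((X j).card : ℝ) - a j r| ≤ α}) ?_ ?_ ?_
    · simp only [Set.ofPred_forall]
      exact MeasurableSet.iInter fun j =>
        measurableSet_le (measurable_const.sub (ha j)).abs measurable_const
    · have := ENNReal.toReal_mono (by finiteness) (hacc X)
      rwa [ENNReal.toReal_ofReal (by norm_num)] at this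
    · intro r hr j
      refine abs_clamp_sub_le ?_ ?_
      · have h1 : ((X j).card : ℝ) / n ≤ 1 := by
          rw [div_le_one hn']; exact_mod_cast card_le_n _
        have h2 : (0 : ℝ) ≤ ((X j).card : ℝ) / n := by positivity
        rw [abs_le]; constructor <;> linarith
      · have h1 : a j r / n - 1 / 2 - ((X j).card / n - 1 / 2) = -(((X j).card - a j r) / n) := by
          ring
        rw [h1, abs_neg, abs_div, abs_of_pos hn', div_le_iff₀ hn']
        linarith [hr j]
  have hsum : ∑ X, matrixWeight X * (∑ j, ((X j).card / n - 1 / 2) *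
      ((2 * ((X j).card : ℝ) - n) / (n + 1)) - d * (1 / 20 + 1 / 100)) ≤
      n * (2 * ε * Real.sqrt d + 2 * δ * d) :=
    (Finset.sum_le_sum fun X _ =>
      mul_le_mul_of_nonneg_left (hlower X) (matrixWeight_nonneg X)).trans hupper
  simp only [mul_sub (matrixWeight _), Finset.sum_sub_distrib] at hsum
  rw [← Finset.sum_mul, sum_matrixWeight] at hsum
  simp only [Finset.mul_sum (Finset.univ : Finset (Fin d))] at hsum
  rw [Finset.sum_comm] at hsum
  have hmain : (d : ℝ) * (1 / 6) ≤ ∑ j : Fin d, ∑ X : Fin d → Finset (Fin n), matrixWeight X *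
      (((X j).card / n - 1 / 2) * ((2 * ((X j).card : ℝ) - n) / (n + 1))) := by
    calc (d : ℝ) * (1 / 6) = ∑ _j : Fin d, (1 / 6 : ℝ) := by simp
      _ ≤ _ := Finset.sum_le_sum fun j _ => by
        rw [sum_matrixWeight_mul j fun S =>
          ((S.card : ℝ) / n - 1 / 2) * ((2 * (S.card : ℝ) - n) / (n + 1))]
        exact sum_priorWeight_mul_marginal hn
  have hss : Real.sqrt d * Real.sqrt d = d := Real.mul_self_sqrt (by positivity)
  -- Privacy gives at most `d / 40 + d / 40`, while accuracy gives at least `(1/6 - 1/20 - 1/100) d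
  -- > d / 10`.
  have h1 := mul_le_mul_of_nonneg_right hnε (Real.sqrt_nonneg d)
  have h2 := mul_le_mul_of_nonneg_right hnδ hd'.le
  nlinarith

end Marginals

/-! ### Packing bound for marginals under pure privacy -/

section Packing
variable {n d : ℕ} {Ω : Type*} [MeasurableSpace Ω]
  (P : (Fin d → Finset (Fin n)) → Measure Ω)

/-- Group privacy: the rows in `R` are erased one at a time, each at the price of a factor `e^ε`. -/
theorem measure_le_exp_card_mul {ε : ℝ}
    (hDP : ∀ X i S, MeasurableSet S →
      P X S ≤ ENNReal.ofReal (Real.exp ε) * P (eraseRow i X) S)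
    (X : Fin d → Finset (Fin n)) (R : Finset (Fin n)) {S : Set Ω} (hS : MeasurableSet S) :
    P X S ≤ ENNReal.ofReal (Real.exp (R.card * ε)) * P (fun j => X j \ R) S := by
  induction R using Finset.induction_on with
  | empty => simp
  | insert i R hi ih =>
    have h1 : eraseRow i (fun j => X j \ R) = fun j => X j \ insert i R := by
      funext j
      ext k
      simp only [eraseRow, Finset.mem_erase, Finset.mem_sdiff, Finset.mem_insert]
      tauto
    refine ih.trans ?_
    have h2 := hDP (fun j => X j \ R) i S hS
    rw [h1] at h2
    rw [Finset.card_insert_of_notMem hi, Nat.cast_add, Nat.cast_one, add_mul, one_mul,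
      Real.exp_add, ENNReal.ofReal_mul (Real.exp_nonneg _), mul_assoc]
    gcongr

variable [∀ X, IsProbabilityMeasure (P X)]

/-- The error of purely differentially private answers to one-way marginal queries. -/
theorem marginals_packing_bound (hd : 0 < d) {ε α : ℝ} (hnε : 2 * n * ε ≤ d)
    (hDP : ∀ X i S, MeasurableSet S →
      P X S ≤ ENNReal.ofReal (Real.exp ε) * P (eraseRow i X) S)
    {a : Fin d → Ω → ℝ} (ha : ∀ j, Measurable (a j))
    (hacc : ∀ X, ENNReal.ofReal 0.99 ≤ P X {r | ∀ j, |((X j).card : ℝ) - a j r| ≤ α}) :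
    (n : ℝ) / 2 ≤ α := by
  classical
  by_contra! hlt
  have hd' : (1 : ℝ) ≤ d := by exact_mod_cast hd
  let D : Finset (Fin d) → Fin d → Finset (Fin n) := fun v j => if j ∈ v then Finset.univ else ∅
  let G : Finset (Fin d) → Set Ω := fun v => {r | ∀ j, |((D v j).card : ℝ) - a j r| ≤ α}
  have hG : ∀ v, MeasurableSet (G v) := fun v => by
    simp only [G, Set.ofPred_forall]
    exact MeasurableSet.iInter fun j =>
      measurableSet_le (measurable_const.sub (ha j)).abs measurable_const
  -- Where `v` and `v'` differ, the true counts are `n` and `0`, too far apart for one answer with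
  -- error `α < n / 2`.
  have hdisj : Pairwise (Function.onFun Disjoint G) := by
    intro v v' hne
    rw [Function.onFun, Set.disjoint_left]
    intro r hr hr'
    apply hne
    ext j
    by_contra hiff
    have h1 := abs_le.1 (hr j)
    have h2 := abs_le.1 (hr' j)
    by_cases hv : j ∈ v <;> by_cases hv' : j ∈ v' <;>
      simp only [D, hv, hv', if_true, if_false, Finset.card_univ, Fintype.card_fin,
        Finset.card_empty, Nat.cast_zero, not_true_eq_false, iff_true, iff_false] at h1 h2 hiff
    · linarith
    · linarith
  have hreal : ∀ v, 0.99 * Real.exp (-(n * ε)) ≤ (P fun _ => ∅).real (G v) := by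
    intro v
    have h1 := (hacc (D v)).trans (measure_le_exp_card_mul P hDP (D v) Finset.univ (hG v))
    have h2 : (fun j => D v j \ Finset.univ) = fun _ => ∅ := by funext j; simp
    rw [h2, Finset.card_univ, Fintype.card_fin] at h1
    have h3 := ENNReal.toReal_mono (by finiteness) h1
    rw [ENNReal.toReal_ofReal (by norm_num), ENNReal.toReal_mul,
      ENNReal.toReal_ofReal (Real.exp_nonneg _)] at h3
    have h4 := mul_le_mul_of_nonneg_right h3 (Real.exp_nonneg (-(n * ε)))
    have h5 : Real.exp (n * ε) * Real.exp (-(n * ε)) = 1 := by rw [← Real.exp_add]; simp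
    calc _ ≤ _ := h4
      _ = (Real.exp (n * ε) * Real.exp (-(n * ε))) * (P fun _ => ∅).real (G v) := by
          rw [measureReal_def]; ring
      _ = _ := by rw [h5, one_mul]
  have htotal : ∑ v, (P fun _ => ∅).real (G v) ≤ 1 := by
    rw [← measureReal_biUnion_finset (fun v _ v' _ h => hdisj h) fun v _ => hG v]
    exact measureReal_le_one
  have hcount : (2 : ℝ) ^ d * (0.99 * Real.exp (-(n * ε))) ≤ 1 := by
    refine le_trans ?_ htotal
    calc (2 : ℝ) ^ d * (0.99 * Real.exp (-(n * ε)))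
        = ∑ _v : Finset (Fin d), 0.99 * Real.exp (-(n * ε)) := by simp
      _ ≤ _ := Finset.sum_le_sum fun v _ => hreal v
  have hexp : Real.exp (-(1 / 2)) ^ d ≤ Real.exp (-(n * ε)) := by
    rw [← Real.exp_nat_mul, Real.exp_le_exp]
    linarith
  have hhalf : (3 / 5 : ℝ) ≤ Real.exp (-(1 / 2)) := by
    have h1 : Real.exp (-(1 / 2)) ^ 2 = (Real.exp 1)⁻¹ := by
      rw [← Real.exp_nat_mul, ← Real.exp_neg]; norm_num
    have h2 : (0.36 : ℝ) ≤ (Real.exp 1)⁻¹ := by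
      rw [le_inv_comm₀ (by norm_num) (Real.exp_pos 1)]
      exact Real.exp_one_lt_d9.le.trans (by norm_num)
    refine le_of_sq_le_sq ?_ (Real.exp_nonneg _)
    rw [h1]; norm_num at h2 ⊢; exact h2
  -- Since `nε ≤ d / 2`, the total mass would be at least `0.99 * 6 / 5 > 1`.
  have hpow : (6 / 5 : ℝ) ≤ (2 * Real.exp (-(1 / 2))) ^ d :=
    calc (6 / 5 : ℝ) = (6 / 5) ^ 1 := by norm_num
      _ ≤ (6 / 5) ^ d := pow_le_pow_right₀ (by norm_num) hd
      _ ≤ _ := pow_le_pow_left₀ (by norm_num) (by linarith) _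
  rw [mul_pow] at hpow
  have : (2 : ℝ) ^ d * Real.exp (-(1 / 2)) ^ d ≤ 2 ^ d * Real.exp (-(n * ε)) := by gcongr
  linarith

end Packing

/-! ### From CountDistinct to marginals -/

section Reduction
variable {U : Type u} {T n d w : ℕ}

theorem nonempty_fin_embedding (h : (n : ℕ∞) ≤ ENat.card U) : Nonempty (Fin n ↪ U) := by
  cases finite_or_infinite U
  · have := Fintype.ofFinite U
    rw [ENat.card_eq_coe_fintype_card, Nat.cast_le] at h
    exact Function.Embedding.nonempty_of_card_le (by simpa using h)
  · exact ⟨Fin.valEmbedding.trans (Infinite.natEmbedding U)⟩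

theorem Mechanism.AccurateUpTo.le_law_encode {M : Mechanism U T} {α : ℝ}
    (hM : M.AccurateUpTo w α) (e : Fin n ↪ U) (hn : 0 < n) (hw : 2 * d ≤ w) (hT : 2 * n * d ≤ T)
    (X : Fin d → Finset (Fin n)) :
    ENNReal.ofReal 0.99 ≤
      M.law (encode e X) {r | ∀ j, |((X j).card : ℝ) - r (queryTime hn hT j)| ≤ α} := by
  refine (hM _ ((maxFlippancy_encode e X).trans hw)).trans (measure_mono fun r hr j => ?_)
  have h := (norm_le_pi_norm _ (queryTime hn hT j)).trans hr
  simpa [countDistinct_encode, Real.norm_eq_abs] using h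

theorem Mechanism.ItemLevelDP.approx_lower_bound {M : Mechanism U T} {ε δ α : ℝ}
    (hDP : M.ItemLevelDP ε δ) (hM : M.AccurateUpTo w α) (hn : 0 < n) (hd : 0 < d)
    (hw : 2 * d ≤ w) (hT : 2 * n * d ≤ T) (hU : (n : ℕ∞) ≤ ENat.card U) (hε : 0 ≤ ε)
    (hε1 : ε ≤ 1) (hδ : 0 ≤ δ) (hnε : 80 * n * ε ≤ Real.sqrt d) (hnδ : 80 * n * δ ≤ 1) :
    (n : ℝ) / 20 ≤ α := by
  obtain ⟨e⟩ := nonempty_fin_embedding hU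
  have := M.isProb
  exact marginals_lower_bound (fun X : Fin d → Finset (Fin n) => M.law (encode e X)) hn hd hε hε1
    hδ hnε hnδ (fun X i S hS => hDP _ _ ⟨e i, Or.inl (erasesItem_encode e X i)⟩ S hS)
    (fun X i S hS => hDP _ _ ⟨e i, Or.inr (erasesItem_encode e X i)⟩ S hS)
    (fun j => measurable_pi_apply (queryTime hn hT j)) (hM.le_law_encode e hn hw hT)

theorem Mechanism.ItemLevelDP.pure_lower_bound {M : Mechanism U T} {ε α : ℝ}
    (hDP : M.ItemLevelDP ε 0) (hM : M.AccurateUpTo w α) (hn : 0 < n) (hd : 0 < d)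
    (hw : 2 * d ≤ w) (hT : 2 * n * d ≤ T) (hU : (n : ℕ∞) ≤ ENat.card U)
    (hnε : 2 * n * ε ≤ d) :
    (n : ℝ) / 2 ≤ α := by
  obtain ⟨e⟩ := nonempty_fin_embedding hU
  have := M.isProb
  refine marginals_packing_bound (fun X : Fin d → Finset (Fin n) => M.law (encode e X)) hd hnε
    (fun X i S hS => ?_)
    (fun j => measurable_pi_apply (queryTime hn hT j)) (hM.le_law_encode e hn hw hT)
  have h := hDP _ _ ⟨e i, Or.inl (erasesItem_encode e X i)⟩ S hS
  rwa [ENNReal.ofReal_zero, add_zero] at h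

end Reduction

/-! ### Numerical properties of the two minima -/

section Bounds
variable {w T : ℕ} {ε : ℝ}

theorem le_approxDPBound (hw : 200 ^ 3 ≤ w) (hwT : w ≤ T) (hε : 0 < ε) (hε1 : ε ≤ 1) :
    200 ≤ approxDPBound w T ε := by
  have hw' : (200 : ℝ) ^ 3 ≤ w := by exact_mod_cast hw
  have hT' : (200 : ℝ) ^ 3 ≤ T := hw'.trans (by exact_mod_cast hwT)
  refine le_min (le_min ?_ ?_) ?_
  · rw [le_div_iff₀ hε]
    have : (200 : ℝ) ≤ Real.sqrt w := Real.le_sqrt_of_sq_le (by linarith)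
    nlinarith
  · rw [le_div_iff₀ (Real.rpow_pos_of_pos hε _)]
    have h1 : (200 : ℝ) ≤ (T : ℝ) ^ (1 / 3 : ℝ) := by
      have := Real.rpow_le_rpow (by positivity) hT' (show (0 : ℝ) ≤ 1 / 3 by norm_num)
      rwa [← Real.rpow_natCast, ← Real.rpow_mul (by norm_num), show ((3 : ℕ) : ℝ) * (1 / 3) = 1 by
        norm_num, Real.rpow_one] at this
    have h2 : ε ^ (2 / 3 : ℝ) ≤ 1 := Real.rpow_le_one hε.le hε1 (by norm_num)
    linarith
  · linarith

theorem approxDPBound_sq_mul_le (hε : 0 < ε) {f : ℝ} (hf : 0 ≤ f)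
    (h : f ≤ approxDPBound w T ε) : f ^ 2 * ε ^ 2 ≤ w := by
  have h1 := h.trans ((min_le_left _ _).trans (min_le_left _ _))
  rw [le_div_iff₀ hε] at h1
  rw [← mul_pow, ← Real.sq_sqrt (Nat.cast_nonneg w)]
  exact pow_le_pow_left₀ (by positivity) h1 2

theorem approxDPBound_cube_mul_le (hε : 0 < ε) {f : ℝ} (hf : 0 ≤ f)
    (h : f ≤ approxDPBound w T ε) : f ^ 3 * ε ^ 2 ≤ T := by
  have h1 := h.trans ((min_le_left _ _).trans (min_le_right _ _))
  rw [le_div_iff₀ (Real.rpow_pos_of_pos hε _)] at h1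
  have h2 := pow_le_pow_left₀ (by positivity) h1 3
  have h3 : (ε ^ (2 / 3 : ℝ)) ^ 3 = ε ^ 2 := by
    rw [← Real.rpow_natCast, ← Real.rpow_mul hε.le, ← Real.rpow_natCast]
    norm_num
  have h4 : ((T : ℝ) ^ (1 / 3 : ℝ)) ^ 3 = T := by
    rw [← Real.rpow_natCast, ← Real.rpow_mul (Nat.cast_nonneg T)]
    norm_num
  rwa [mul_pow, h3, h4] at h2

theorem le_pureDPBound (hw : 64 ≤ w) (hwT : w ≤ T) (hε : 0 < ε) (hε1 : ε ≤ 1) :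
    8 ≤ pureDPBound w T ε := by
  have hw' : (64 : ℝ) ≤ w := by exact_mod_cast hw
  have hT' : (64 : ℝ) ≤ T := hw'.trans (by exact_mod_cast hwT)
  refine le_min (le_min ?_ (Real.le_sqrt_of_sq_le ?_)) ?_
  · rw [le_div_iff₀ hε]; linarith
  · rw [le_div_iff₀ hε]; linarith
  · linarith

theorem pureDPBound_mul_le (hε : 0 < ε) : pureDPBound w T ε * ε ≤ w := by
  rw [← le_div_iff₀ hε]
  exact (min_le_left _ _).trans (min_le_left _ _)

theorem pureDPBound_sq_mul_le (hε : 0 < ε) (h0 : 0 ≤ pureDPBound w T ε) :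
    pureDPBound w T ε ^ 2 * ε ≤ T := by
  rw [← le_div_iff₀ hε, ← Real.sq_sqrt (show (0 : ℝ) ≤ T / ε by positivity)]
  exact pow_le_pow_left₀ h0 ((min_le_left _ _).trans (min_le_right _ _)) 2

end Bounds

/-- The lower bound for approximate differential privacy, without a loss of logarithmic factors. -/
theorem approxDPBound_le_error {w T : ℕ} (hw : 200 ^ 3 ≤ w) (hwT : w ≤ T) {ε δ : ℝ} (hε : 0 < ε)
    (hε1 : ε ≤ 1) (hδ : 0 ≤ δ) (hδT : δ ≤ 1 / 80 * (ε / T)) {U : Type u}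
    (hU : (T : ℕ∞) ≤ ENat.card U) {M : Mechanism U T} {α : ℝ} (hDP : M.ItemLevelDP ε δ)
    (hM : M.AccurateUpTo w α) : approxDPBound w T ε / 8000 ≤ α := by
  have hf := le_approxDPBound hw hwT hε hε1
  have hfT : approxDPBound w T ε ≤ T := min_le_right _ _
  have hf2 := approxDPBound_sq_mul_le hε (by linarith) (le_refl (approxDPBound w T ε))
  have hf3 := approxDPBound_cube_mul_le hε (by linarith) (le_refl (approxDPBound w T ε))
  have hw' : (200 : ℝ) ^ 3 ≤ w := by exact_mod_cast hw
  have hT0 : (0 : ℝ) < T := by linarith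
  generalize approxDPBound w T ε = f at *
  -- As `f ≥ 200`, rounding down costs at most a factor `2`: `f < 400 n`, so `n / 20` exceeds `f /
  -- 8000`.
  obtain ⟨n, hndef⟩ : ∃ n, n = ⌊f / 200⌋₊ := ⟨_, rfl⟩
  have hnf : (n : ℝ) ≤ f / 200 := hndef ▸ Nat.floor_le (by linarith)
  have hfn : f / 200 < n + 1 := hndef ▸ Nat.lt_floor_add_one _
  have hn : 0 < n := hndef ▸ Nat.floor_pos.2 (by linarith)
  have hn1 : (1 : ℝ) ≤ n := by exact_mod_cast hn
  -- This is the least `d` with `80 n ε ≤ √d`. Then `f² ε² ≤ w` yields `2d ≤ w`, and `f³ ε² ≤ T`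
  -- together with `f ≤ T` yields `2nd ≤ T`; the factor `200` leaves room for the rounding.
  obtain ⟨d, hddef⟩ : ∃ d, d = ⌈(80 * n * ε) ^ 2⌉₊ := ⟨_, rfl⟩
  have hd : 0 < d := hddef ▸ Nat.ceil_pos.2 (by positivity)
  have hdle : (80 * n * ε) ^ 2 ≤ d := hddef ▸ Nat.le_ceil _
  have hdlt : (d : ℝ) < (80 * n * ε) ^ 2 + 1 := hddef ▸ Nat.ceil_lt_add_one (by positivity)
  have hn2 : (n : ℝ) ^ 2 * ε ^ 2 ≤ w / 200 ^ 2 := by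
    calc (n : ℝ) ^ 2 * ε ^ 2 ≤ (f / 200) ^ 2 * ε ^ 2 := by gcongr
      _ = f ^ 2 * ε ^ 2 / 200 ^ 2 := by ring
      _ ≤ _ := by gcongr
  have hn3 : (n : ℝ) ^ 3 * ε ^ 2 ≤ T / 200 ^ 3 := by
    calc (n : ℝ) ^ 3 * ε ^ 2 ≤ (f / 200) ^ 3 * ε ^ 2 := by gcongr
      _ = f ^ 3 * ε ^ 2 / 200 ^ 3 := by ring
      _ ≤ _ := by gcongr
  have hdw : 2 * d ≤ w := by
    have : (2 : ℝ) * d ≤ w := by nlinarith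
    exact_mod_cast this
  have hnd : 2 * n * d ≤ T := by
    have h1 : (n : ℝ) * d ≤ n * ((80 * n * ε) ^ 2 + 1) := by gcongr
    have : (2 : ℝ) * n * d ≤ T := by nlinarith
    exact_mod_cast this
  have hnT : n ≤ T := by
    have : (n : ℝ) ≤ T := by linarith
    exact_mod_cast this
  have hnδ : 80 * n * δ ≤ 1 := by
    calc 80 * n * δ ≤ 80 * n * (1 / 80 * (ε / T)) := by gcongr
      _ = n * ε / T := by ring
      _ ≤ 1 := by
        rw [div_le_one hT0]
        nlinarith [show (n : ℝ) ≤ T by exact_mod_cast hnT]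
  have := hDP.approx_lower_bound hM hn hd hdw hnd (le_trans (by exact_mod_cast hnT) hU) hε.le hε1
    hδ (Real.le_sqrt_of_sq_le hdle) hnδ
  linarith

/-- The lower bound for pure differential privacy. -/
theorem pureDPBound_le_error {w T : ℕ} (hw : 64 ≤ w) (hwT : w ≤ T) {ε : ℝ} (hε : 0 < ε)
    (hε1 : ε ≤ 1) {U : Type u} (hU : (T : ℕ∞) ≤ ENat.card U) {M : Mechanism U T} {α : ℝ}
    (hDP : M.ItemLevelDP ε 0) (hM : M.AccurateUpTo w α) : pureDPBound w T ε / 32 ≤ α := by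
  have hf := le_pureDPBound hw hwT hε hε1
  have hfT : pureDPBound w T ε ≤ T := min_le_right _ _
  have hf1 := pureDPBound_mul_le (w := w) (T := T) hε
  have hf2 := pureDPBound_sq_mul_le (w := w) (T := T) hε (by linarith)
  have hw' : (64 : ℝ) ≤ w := by exact_mod_cast hw
  generalize pureDPBound w T ε = f at *
  obtain ⟨n, hndef⟩ : ∃ n, n = ⌊f / 8⌋₊ := ⟨_, rfl⟩
  have hnf : (n : ℝ) ≤ f / 8 := hndef ▸ Nat.floor_le (by linarith)
  have hfn : f / 8 < n + 1 := hndef ▸ Nat.lt_floor_add_one _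
  have hn : 0 < n := hndef ▸ Nat.floor_pos.2 (by linarith)
  have hn1 : (1 : ℝ) ≤ n := by exact_mod_cast hn
  -- The packing needs `d` only linear in `nε`, which is why `w` enters without a square root here.
  obtain ⟨d, hddef⟩ : ∃ d, d = ⌈2 * n * ε⌉₊ := ⟨_, rfl⟩
  have hd : 0 < d := hddef ▸ Nat.ceil_pos.2 (by positivity)
  have hdle : 2 * n * ε ≤ d := hddef ▸ Nat.le_ceil _
  have hdlt : (d : ℝ) < 2 * n * ε + 1 := hddef ▸ Nat.ceil_lt_add_one (by positivity)
  have hn2 : (n : ℝ) * ε ≤ w / 8 := by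
    calc (n : ℝ) * ε ≤ f / 8 * ε := by gcongr
      _ = f * ε / 8 := by ring
      _ ≤ _ := by gcongr
  have hn3 : (n : ℝ) ^ 2 * ε ≤ T / 64 := by
    calc (n : ℝ) ^ 2 * ε ≤ (f / 8) ^ 2 * ε := by gcongr
      _ = f ^ 2 * ε / 64 := by ring
      _ ≤ _ := by gcongr
  have hdw : 2 * d ≤ w := by
    have : (2 : ℝ) * d ≤ w := by linarith
    exact_mod_cast this
  have hnd : 2 * n * d ≤ T := by
    have h1 : (n : ℝ) * d ≤ n * (2 * n * ε + 1) := by gcongr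
    have : (2 : ℝ) * n * d ≤ T := by nlinarith
    exact_mod_cast this
  have hnT : n ≤ T := by
    have : (n : ℝ) ≤ T := by linarith
    exact_mod_cast this
  have := hDP.pure_lower_bound hM hn hd hdw hnd (le_trans (by exact_mod_cast hnT) hU) hdle
  linarith

end TurnstileDP

theorem theorem1p7 :
    -- approximate differential privacy: `η`, `c`, `k`, `N` are absolute constants;
    -- `Ω̃(f)` means at least a constant times `f / log f ^ k` for some fixed `k`
    (∃ η : ℝ, 0 < η ∧ ∃ c : ℝ, 0 < c ∧ ∃ k N : ℕ,
      ∀ w T : ℕ, N ≤ w → w ≤ T →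
      ∀ ε δ : ℝ, 0 < ε → ε ≤ 1 → 0 ≤ δ → δ ≤ η * (ε / T) →
      ∀ U : Type u, (T : ℕ∞) ≤ ENat.card U →
      ∀ (M : TurnstileDP.Mechanism U T) (α : ℝ),
        M.ItemLevelDP ε δ → M.AccurateUpTo w α →
        c * (TurnstileDP.approxDPBound w T ε /
          Real.log (TurnstileDP.approxDPBound w T ε) ^ k) ≤ α) ∧
    -- pure differential privacy: `c`, `N` are absolute constants
    (∃ c : ℝ, 0 < c ∧ ∃ N : ℕ,
      ∀ w T : ℕ, N ≤ w → w ≤ T →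
      ∀ ε : ℝ, 0 < ε → ε ≤ 1 →
      ∀ U : Type u, (T : ℕ∞) ≤ ENat.card U →
      ∀ (M : TurnstileDP.Mechanism U T) (α : ℝ),
        M.ItemLevelDP ε 0 → M.AccurateUpTo w α →
        c * TurnstileDP.pureDPBound w T ε ≤ α) := by
  -- The exponent `k = 0` is possible because no logarithm is lost. The thresholds `200 ^ 3` and
  -- `64` make the minima at least `200` and `8`, so that `n ≥ 1`.
  refine ⟨⟨1 / 80, by norm_num, 1 / 8000, by norm_num, 0, 200 ^ 3, ?_⟩,
    ⟨1 / 32, by norm_num, 64, ?_⟩⟩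
  · intro w T hw hwT ε δ hε hε1 hδ hδT U hU M α hDP hM
    have := TurnstileDP.approxDPBound_le_error hw hwT hε hε1 hδ hδT hU hDP hM
    rw [pow_zero, div_one]
    linarith
  · intro w T hw hwT ε hε hε1 U hU M α hDP hM
    have := TurnstileDP.pureDPBound_le_error hw hwT hε hε1 hU hDP hM
    linarith
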